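/- Let $G=(V,E)$ be a finite simple proper interval graph with $n$ vertices, that is, the intersection graph of a family of real intervals none of which is properly contained in another. An ordering of $V$ is a bijection from $V$ onto $\{1,\dots,n\}$; $u\prec_\sigma v$ means $\sigma(u)<\sigma(v)$, and $\sigma^d$ is the reverse of $\sigma$. An ordering $\sigma$ is a PI-order of $G$ if $a\prec_\sigma b\prec_\sigma c$ and $ac\in E$ imply $ab\in E$ and $bc\in E$. LexBFS, from a start vertex $s$, gives $s$ the one-letter label $n+1$ and every other vertex the empty label. In step $i=1,\dots,n$ it numbers by $i$ some unnumbered vertex $v$ whose label is lexicographically largest (ties are broken arbitrarily), and appends the letter $n-i$ to the label of each unnumbered neighbour of $v$. For an ordering $\sigma$, $\mathrm{LexBFS}^+(\sigma)$ is the ordering computed by LexBFS, with all labels initially empty, when among the tied vertices the one rightmost in $\sigma$ is always picked (so the search starts at the last vertex of $\sigma$). Let $\sigma_1$ be any LexBFS ordering of $G$, for any start vertex and any breaking of ties, and let $\sigma_{i+1}=\mathrm{LexBFS}^+(\sigma_i)$ for $i\ge 1$. Then $\sigma_3$ is a PI-order of $G$, $\sigma_4=\sigma_3^d$, and $\sigma_5=\sigma_3$.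 Consequently the algorithm that computes $\sigma_1,\sigma_2,\sigma_3$, sets $i=3$ and, while $\sigma_i\neq\sigma_{i-2}$, increases $i$ by one and computes $\sigma_i=\mathrm{LexBFS}^+(\sigma_{i-1})$, stops with a final index $i\le 5$. -/

import Mathlib

/-- A graph is a *proper interval graph* if its vertices can be represented by nonempty closed
real intervals `[l v, r v]`, no one of them properly contained in another, so that two distinct
vertices are adjacent exactly when their intervals intersect. -/
def IsProperIntervalGraph {V : Type*} (G : SimpleGraph V) : Prop :=
  ∃ l r : V → ℝ, (∀ v, l v ≤ r v) ∧
    (∀ u v, ¬ Set.Icc (l u) (r u) ⊂ Set.Icc (l v) (r v)) ∧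
    ∀ u v, G.Adj u v ↔ u ≠ v ∧ (Set.Icc (l u) (r u) ∩ Set.Icc (l v) (r v)).Nonempty

/-- An *ordering* of the vertex set: a bijection from the `n` vertices onto the `n` positions
(numbered from `0` to `n - 1`). The vertex `u` is to the left of `v` in `σ` if `σ u < σ v`. -/
abbrev VertexOrdering (V : Type*) [Fintype V] : Type _ := V ≃ Fin (Fintype.card V)

/-- The dual (reverse) ordering. -/
def VertexOrdering.dual {V : Type*} [Fintype V] (σ : VertexOrdering V) : VertexOrdering V :=
  σ.trans Fin.revPerm

/-- The ordering `σ` written as the list of its vertices, from left to right. -/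
def VertexOrdering.vertexList {V : Type*} [Fintype V] (σ : VertexOrdering V) : List V :=
  List.ofFn σ.symm

/-- A *PI-order* of `G`: for all `a`, `b`, `c` in this order from left to right,
if `a c` is an edge, then so are `a b` and `b c`. -/
def IsPIOrder {V : Type*} [Fintype V] (G : SimpleGraph V) (σ : VertexOrdering V) : Prop :=
  ∀ a b c : V, σ a < σ b → σ b < σ c → G.Adj a c → G.Adj a b ∧ G.Adj b c

/-- A state of lexicographic breadth first search: the list of the vertices numbered so far,
in the order in which they were numbered, and the current label of each vertex. -/
structure LexBFSState (V : Type*) where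
  /-- The vertices numbered so far. -/
  visited : List V
  /-- The labels, words of natural numbers (compared lexicographically). -/
  label : V → List ℕ

namespace LexBFSState

variable {V : Type*} [Fintype V] [DecidableEq V]

/-- Initially no vertex is numbered, and all labels are the empty word, except
that the label of the start vertex `s` is the one-letter word `n + 1`. -/
def init (s : V) : LexBFSState V where
  visited := []
  label w := if w = s then [Fintype.card V + 1] else []

/-- The initial state without a prescribed start vertex: all labels are the empty word. -/
def initTied : LexBFSState V where
  visited := []
  label _ := []

/-- The vertex `v` may be picked next: it is unnumbered, and its label is lexicographically
largest among the labels of the unnumbered vertices. -/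
def Eligible (st : LexBFSState V) (v : V) : Prop :=
  v ∉ st.visited ∧ ∀ w, w ∉ st.visited → st.label w ≤ st.label v

instance (st : LexBFSState V) : DecidablePred st.Eligible := fun _ =>
  inferInstanceAs (Decidable (_ ∧ _))

/-- The set of tied vertices: those that may be picked next. -/
def tied (st : LexBFSState V) : Finset V := Finset.univ.filter st.Eligible

/-- Number the vertex `v`: if it is the `i`-th vertex to be numbered (`i = 1, …, n`), the letter
`n - i` is appended to the label of each unnumbered neighbour of `v`. -/
def visit (G : SimpleGraph V) [DecidableRel G.Adj] (st : LexBFSState V) (v : V) :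
    LexBFSState V where
  visited := st.visited ++ [v]
  label w :=
    if w ∉ st.visited ++ [v] ∧ G.Adj v w then
      st.label w ++ [Fintype.card V - (st.visited.length + 1)]
    else st.label w

/-- The states that LexBFS with start vertex `s` can reach; ties are broken arbitrarily. -/
inductive Reachable (G : SimpleGraph V) [DecidableRel G.Adj] (s : V) : LexBFSState V → Prop
  | start : Reachable G s (init s)
  | step (st : LexBFSState V) (v : V) :
      Reachable G s st → st.Eligible v → Reachable G s (st.visit G v)

/-- One step of LexBFS with the `+` rule: among the tied vertices, the one that is
rightmost in `σ` is picked. (Nothing happens once all the vertices are numbered.) -/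
def plusStep (G : SimpleGraph V) [DecidableRel G.Adj] (σ : VertexOrdering V)
    (st : LexBFSState V) : LexBFSState V :=
  if h : st.tied.Nonempty then
    st.visit G (σ.symm ((st.tied.image σ).max' (h.image σ)))
  else st

/-- The state after `k` steps of LexBFS with the `+` rule with respect to `σ`. At the beginning
all vertices are tied, so that the search starts at the rightmost vertex of `σ`. -/
def plusState (G : SimpleGraph V) [DecidableRel G.Adj] (σ : VertexOrdering V) (k : ℕ) :
    LexBFSState V :=
  (plusStep G σ)^[k] initTied

theorem tied_nonempty (st : LexBFSState V) (h : st.visited.length < Fintype.card V) :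
    st.tied.Nonempty := by
  have hne : (Finset.univ.filter (fun v => v ∉ st.visited)).Nonempty := by
    by_contra hcon
    rw [Finset.not_nonempty_iff_eq_empty, Finset.filter_eq_empty_iff] at hcon
    have hall : st.visited.toFinset = Finset.univ := by
      ext v
      simpa using hcon (Finset.mem_univ v)
    have hle := st.visited.toFinset_card_le
    rw [hall, Finset.card_univ] at hle
    omega
  obtain ⟨v, hv, hmax⟩ := Finset.exists_max_image _ st.label hne
  refine ⟨v, ?_⟩
  simp only [tied, Finset.mem_filter, Finset.mem_univ, true_and] at hv hmax ⊢
  exact ⟨hv, hmax⟩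

theorem plusState_nodup_length (G : SimpleGraph V) [DecidableRel G.Adj] (σ : VertexOrdering V)
    (k : ℕ) (hk : k ≤ Fintype.card V) :
    (plusState G σ k).visited.Nodup ∧ (plusState G σ k).visited.length = k := by
  induction k with
  | zero => exact ⟨List.nodup_nil, rfl⟩
  | succ k ih =>
    obtain ⟨hnd, hlen⟩ := ih (by omega)
    have hne := tied_nonempty (plusState G σ k) (by omega)
    have hs : plusState G σ (k + 1) = plusStep G σ (plusState G σ k) :=
      Function.iterate_succ_apply' _ _ _
    have hmem : σ.symm (((plusState G σ k).tied.image σ).max' (hne.image σ)) ∈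
        (plusState G σ k).tied := by
      obtain ⟨x, hx, hxe⟩ := Finset.mem_image.1 (Finset.max'_mem _ (hne.image σ))
      rw [← hxe]
      simpa using hx
    have hnot := (Finset.mem_filter.1 hmem).2.1
    rw [hs, plusStep, dif_pos hne]
    constructor
    · exact List.nodup_append.2 ⟨hnd, List.nodup_singleton _, by
        intro a ha b hb hab
        rw [List.mem_singleton] at hb
        exact hnot (hb ▸ hab ▸ ha)⟩
    · simp [visit, hlen]

theorem mem_plusState (G : SimpleGraph V) [DecidableRel G.Adj] (σ : VertexOrdering V) (v : V) :
    v ∈ (plusState G σ (Fintype.card V)).visited := by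
  obtain ⟨hnd, hlen⟩ := plusState_nodup_length G σ _ le_rfl
  have hcard : (plusState G σ (Fintype.card V)).visited.toFinset = Finset.univ :=
    Finset.eq_univ_of_card _ (by rw [List.toFinset_card_of_nodup hnd, hlen])
  rw [← List.mem_toFinset, hcard]
  exact Finset.mem_univ v

end LexBFSState

/-- `σ` is a LexBFS ordering of `G`: a possible output of LexBFS, for some start vertex
and some way to break the ties. -/
def IsLexBFS {V : Type*} [Fintype V] [DecidableEq V] (G : SimpleGraph V) [DecidableRel G.Adj]
    (σ : VertexOrdering V) : Prop :=
  ∃ (s : V) (st : LexBFSState V), LexBFSState.Reachable G s st ∧ st.visited = σ.vertexList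

/-- The ordering `LexBFS⁺(G, σ)`: the order in which LexBFS with the `+` rule numbers
the vertices in its `n` steps. -/
def lexBFSPlus {V : Type*} [Fintype V] [DecidableEq V] (G : SimpleGraph V) [DecidableRel G.Adj]
    (σ : VertexOrdering V) : VertexOrdering V :=
  ((LexBFSState.plusState_nodup_length G σ _ le_rfl).1.getEquivOfForallMemList _
      (LexBFSState.mem_plusState G σ)).symm.trans
    (finCongr (LexBFSState.plusState_nodup_length G σ _ le_rfl).2)

/-- The sequence of repeated LexBFS⁺ sweeps, with indices starting at `1`:
`sweep G σ₁ 1 = σ₁`, and `sweep G σ₁ (i + 1)` is `LexBFS⁺` of `sweep G σ₁ i` for `i ≥ 1`. -/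
def sweep {V : Type*} [Fintype V] [DecidableEq V] (G : SimpleGraph V) [DecidableRel G.Adj]
    (σ₁ : VertexOrdering V) (i : ℕ) : VertexOrdering V :=
  (lexBFSPlus G)^[i - 1] σ₁

/-- The loop `while σ i ≠ σ (i - 2) do i := i + 1; σ i := LexBFS⁺ (σ (i - 1))`:
if it is entered with the index `i`, it terminates, and the final index is `k`. -/
inductive SweepLoop {V : Type*} [Fintype V] [DecidableEq V] (G : SimpleGraph V)
    [DecidableRel G.Adj] (σ₁ : VertexOrdering V) : ℕ → ℕ → Prop
  | exit (i : ℕ) : sweep G σ₁ i = sweep G σ₁ (i - 2) → SweepLoop G σ₁ i i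
  | next (i k : ℕ) : sweep G σ₁ i ≠ sweep G σ₁ (i - 2) → SweepLoop G σ₁ (i + 1) k →
      SweepLoop G σ₁ i k

/-- The repeated LexBFS⁺ algorithm, whose first sweep is the LexBFS ordering `σ₁`, stops with
index `k` (and returns the ordering `sweep G σ₁ k`): it computes the first three
sweeps, then enters the loop with the index `3`. -/
def RepeatedLexBFSStopsAt {V : Type*} [Fintype V] [DecidableEq V] (G : SimpleGraph V)
    [DecidableRel G.Adj] (σ₁ : VertexOrdering V) (k : ℕ) : Prop :=
  SweepLoop G σ₁ 3 k

/-! Order the vertices by left endpoints of their intervals and work in one component. In this order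
`π` closed neighbourhoods are consecutive, so a vertex is described by where its neighbourhood
starts and ends. LexBFS enters only through the four-point property and, for a `+` sweep, the tie
rule. Call vertices twins if their closed neighbourhoods agree.

The last vertex of the first sweep is a twin of an end of `π` (`last_twin_max`), and the second
sweep begins there. Up to reversal of `π` this is the left end; then vertices with strictly earlier
start come first (`lt_of_startsBefore`), so the second sweep finishes at a twin of the right end.
The third sweep begins there and, symmetrically, puts later ends first; its tie rule prefers later
starts, and together these give a PI-order (`convex_third_of_first_twin_min`). Components are
consecutive in every LexBFS, so the result passes to the whole graph. Finally, a `+` sweep reverses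
any PI-order (`IsPIOrder.lexBFSPlus_eq_dual`), which settles the fourth and fifth sweeps. -/

/-- The four-point property of a lexicographic breadth first search `σ` with respect to a
relation `N`: a vertex `d` that distinguishes `c` from an earlier `b` is preceded by a vertex that
distinguishes `b` from `c`. -/
def FourPoint {α : Type*} (N : α → α → Prop) (σ : α → ℕ) : Prop :=
  ∀ b c d, σ d < σ b → σ b < σ c → N d c → ¬ N d b → ∃ d', σ d' < σ d ∧ N d' b ∧ ¬ N d' c

/-- The tie-breaking property of a `+` sweep `σ` with respect to the ordering `τ`. -/
def PlusTie {α : Type*} (N : α → α → Prop) (τ σ : α → ℕ) : Prop :=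
  ∀ b c, σ b < σ c → τ b < τ c → ∃ d, σ d < σ b ∧ N d b ∧ ¬ N d c

/-- `π` is an ordering in which the vertices of the reflexive and symmetric relation `N` have
consecutive neighbourhoods, and `N` is connected: a vertex that is not the first one has a neighbour
to its left, and a vertex that is not the last one has a neighbour to its right. -/
structure IsStraight {α : Type*} (N : α → α → Prop) (π : α → ℕ) : Prop where
  inj : π.Injective
  refl : ∀ a, N a a
  symm : ∀ a b, N a b → N b a
  convex : ∀ a b c, π a ≤ π b → π b ≤ π c → N a c → N a b ∧ N b c
  left : ∀ a b, π a < π b → ∃ x, π x < π b ∧ N x b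
  right : ∀ a b, π b < π a → ∃ x, π b < π x ∧ N x b

/-- The leftmost neighbour of `b` is to the left of the leftmost neighbour of `c`. -/
def StartsBefore {α : Type*} (N : α → α → Prop) (π : α → ℕ) (b c : α) : Prop :=
  ∃ x, π x < π c ∧ N x b ∧ ¬ N x c

/-- The rightmost neighbour of `b` is to the right of the rightmost neighbour of `c`. -/
def EndsAfter {α : Type*} (N : α → α → Prop) (π : α → ℕ) (b c : α) : Prop :=
  ∃ x, π c < π x ∧ N x b ∧ ¬ N x c

/-! ### Searches of a connected proper interval order -/

namespace IsStraight

variable {α : Type*} {N : α → α → Prop} {π : α → ℕ}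

theorem reverse (h : IsStraight N π) {M : ℕ} (hM : ∀ a, π a ≤ M) :
    IsStraight N (fun a => M - π a) where
  inj a b hab := h.inj (by have := hM a; have := hM b; simp only at hab; omega)
  refl := h.refl
  symm := h.symm
  convex a b c hab hbc hac := by
    have := hM a; have := hM b; have := hM c
    obtain ⟨h1, h2⟩ := h.convex c b a (by omega) (by omega) (h.symm _ _ hac)
    exact ⟨h.symm _ _ h2, h.symm _ _ h1⟩
  left a b hab := by
    have := hM a; have := hM b
    obtain ⟨x, hx, hn⟩ := h.right a b (by omega)
    exact ⟨x, by have := hM x; omega, hn⟩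
  right a b hab := by
    have := hM a; have := hM b
    obtain ⟨x, hx, hn⟩ := h.left a b (by omega)
    exact ⟨x, by have := hM x; omega, hn⟩

theorem startsBefore_reverse {M : ℕ} (hM : ∀ a, π a ≤ M) {b c : α} :
    StartsBefore N (fun a => M - π a) b c ↔ EndsAfter N π b c := by
  refine exists_congr fun x => and_congr_left fun _ => ?_
  have := hM x; have := hM c
  show M - π x < M - π c ↔ π c < π x
  omega

/-- A violating pair `b`, `c` yields a smaller one. Take a neighbour `x` of `b`, left of `b` and not
adjacent to `c`. If `x` is visited before `c`, the four-point property gives `y` visited before `x`,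
and `x`, `y` is a violation with `σ y < σ c`. Otherwise `x`, `c` is one with `π x < π b`. -/
theorem lt_of_startsBefore_of_first (h : IsStraight N π) {σ : α → ℕ} (hσ : σ.Injective)
    (hL : FourPoint N σ) {s : α} (hs : ∀ v, σ s ≤ σ v) (c b : α) (hbc : StartsBefore N π b c)
    (hsc : π s < π c) (hnsc : ¬ N s c) (hsb : N s b ∨ π s < π b) : σ b < σ c := by
  induction hm : σ c using Nat.strong_induction_on generalizing c b with
  | _ m ihc =>
  induction hk : π b using Nat.strong_induction_on generalizing b with
  | _ k ihb =>
  subst hm hk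
  by_contra hcon
  have hcb : σ c < σ b := by
    rcases lt_trichotomy (σ c) (σ b) with h1 | h1 | h1
    · exact h1
    · obtain ⟨x, -, h2, h3⟩ := hbc
      exact absurd (hσ h1 ▸ h2) h3
    · exact absurd h1 hcon
  have hne : ∀ {x y : α}, ¬ N x y → σ x ≠ σ y := fun hn he => hn (hσ he ▸ h.refl _)
  by_cases hb : N s b
  -- The four-point property would require a vertex before the first one.
  · obtain ⟨d', h1, -⟩ := hL c b s (lt_of_le_of_ne (hs c) (hne hnsc)) hcb hb hnsc
    exact absurd (hs d') (by omega)
  have hsb' := hsb.resolve_left hb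
  obtain ⟨x, hxb, hxb', hxc⟩ : ∃ x, π x < π b ∧ N x b ∧ ¬ N x c := by
    obtain ⟨x, hx, hxb, hxc⟩ := hbc
    by_cases hlt : π x < π b
    · exact ⟨x, hlt, hxb, hxc⟩
    obtain ⟨y, hy, hyb⟩ := h.left s b hsb'
    exact ⟨y, hy, hyb, fun hyc => hxc (h.convex y x c (by omega) (by omega) hyc).2⟩
  have hbc' : π b < π c := by
    by_contra hle
    by_cases hxc' : π x ≤ π c
    · exact hxc (h.convex x c b hxc' (by omega) hxb').1
    · obtain ⟨z, hz, hzb, hzc⟩ := hbc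
      exact hzc (h.convex z c b hz.le (by omega) hzb).1
  have hsx : N s x ∨ π s < π x := by
    by_contra hno
    push Not at hno
    exact hno.1 (h.symm _ _ (h.convex x s b hno.2 hsb'.le hxb').1)
  rcases lt_trichotomy (σ x) (σ c) with h1 | h1 | h1
  · obtain ⟨y, hy, hyc, hyb⟩ := hL c b x h1 hcb hxb' hxc
    have hby : π b < π y := by
      by_contra hle
      exact hyb (h.convex y b c (by omega) hbc'.le hyc).1
    have hyb' : ¬ N b y := fun hn => hyb (h.symm _ _ hn)
    have := ihc (σ y) (by omega) y x
      ⟨x, by omega, h.refl x, fun hn => hyb' (h.convex x b y hxb.le hby.le hn).2⟩ (by omega)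
      (fun hn => hyb' (h.convex s b y hsb'.le hby.le hn).2) hsx rfl
    omega
  · exact hne hxc h1
  · have := ihb (π x) hxb x ⟨x, by omega, h.refl x, hxc⟩ hsx rfl
    omega

theorem twin_max_of_not_startsBefore (h : IsStraight N π) {g w : α} (hg : ∀ v, π v ≤ π g)
    (hw : ¬ StartsBefore N π w g) (v : α) : N w v ↔ N g v := by
  have key : ∀ v, N w v → N g v := by
    intro v hv
    by_contra hn
    refine hw ⟨v, lt_of_le_of_ne (hg v) fun he => hn (h.inj he ▸ ?_), h.symm _ _ hv,
      fun hh => hn (h.symm _ _ hh)⟩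
    exact h.refl _
  refine ⟨key v, fun hv => ?_⟩
  have hgw := key w (h.refl w)
  rcases le_total (π v) (π w) with h1 | h1
  · exact h.symm _ _ (h.convex v w g h1 (hg w) (h.symm _ _ hv)).1
  · exact (h.convex w v g h1 (hg v) (h.symm _ _ hgw)).1

/-- If `w` starts before `g` and is not adjacent to `s`, the comparison lemma puts `w` before `g`,
although `w` is last. The delicate case is `s` adjacent to `w`, where `s` must be universal. -/
theorem last_twin_max (h : IsStraight N π) {σ : α → ℕ} (hσ : σ.Injective)
    (hL : FourPoint N σ) {s w f g : α} (hs : ∀ v, σ s ≤ σ v) (hw : ∀ v, σ v ≤ σ w)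
    (hf : ∀ v, π f ≤ π v) (hg : ∀ v, π v ≤ π g) (hsw : π s ≤ π w) (v : α) : N w v ↔ N g v := by
  have hlt : ∀ {x y : α}, σ x ≤ σ y → x ≠ y → σ x < σ y := fun h1 h2 =>
    lt_of_le_of_ne h1 (hσ.ne h2)
  have hne : ∀ {x y : α}, ¬ N x y → x ≠ y := by
    rintro x y h1 rfl
    exact h1 (h.refl x)
  refine h.twin_max_of_not_startsBefore hg (fun hst => ?_) v
  by_cases hsw' : N s w
  swap
  · have := h.lt_of_startsBefore_of_first hσ hL hs g w hst
      (by have := hg w; have := hσ.ne (hne hsw'); have := h.inj.ne (hne hsw'); omega)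
      (fun hn => hsw' (h.convex s w g hsw (hg w) hn).1)
      (Or.inr (lt_of_le_of_ne hsw (h.inj.ne (hne hsw'))))
    exact absurd (hw g) (by omega)
  have huniv : ∀ v, N s v := by
    intro v
    by_contra hv
    obtain ⟨d, hd, -⟩ := hL v w s (hlt (hs v) (hne hv))
      (hlt (hw v) fun he => hv (he ▸ hsw')) hsw' hv
    exact absurd (hs d) (by omega)
  have hwg : N w g := (h.convex s w g hsw (hg w) (huniv g)).2
  have hgw : ∀ v, N v g → N v w := by
    intro v hv
    rcases le_total (π v) (π w) with h1 | h1
    · exact (h.convex v w g h1 (hg w) hv).1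
    · exact h.symm _ _ (h.convex w v g h1 (hg v) hwg).1
  obtain ⟨x, hxg', hxw, hxg⟩ := hst
  have hgw' : σ g < σ w := hlt (hw g) fun he => hxg (he ▸ hxw)
  have hgx : σ g < σ x := by
    by_contra hle
    obtain ⟨d, -, hd, hd'⟩ := hL g w x (hlt (by omega) (hne hxg)) hgw' hxw hxg
    exact hd' (hgw d hd)
  have hxs : π x < π s := by
    by_contra hle
    exact hxg (h.convex s x g (by omega) hxg'.le (huniv g)).2
  -- Adjacent to both ends, `w` would be universal, but the four-point property produces a
  -- non-neighbour of `w`.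
  by_cases hwf : N w f
  · have hxw2 : σ x < σ w := hlt (hw x) (by rintro rfl; exact hxg hwg)
    obtain ⟨d, -, hd, hd'⟩ := hL x w g hgx hxw2 (h.symm _ _ hwg) (fun hn => hxg (h.symm _ _ hn))
    have hwd : N w d := by
      rcases le_total (π d) (π w) with h1 | h1
      · exact h.symm _ _ (h.convex f d w (hf d) h1 (h.symm _ _ hwf)).2
      · exact (h.convex w d g h1 (hg d) hwg).1
    exact hd' (h.symm _ _ hwd)
  have hfw : σ f < σ w := hlt (hw f) fun he => hwf (he ▸ h.refl f)
  have hfw' : ∀ y, N y f → ¬ N y w → π y < π x := by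
    intro y hy hyw
    by_contra hle
    rcases le_total (π y) (π w) with h1 | h1
    · exact hyw (h.convex x y w (by omega) h1 hxw).2
    · exact hwf (h.symm _ _ (h.convex f w y (hf w) h1 (h.symm _ _ hy)).1)
  -- By the four-point property for `f`, `w`, any vertex before `f` that is adjacent to `w` but not
  -- to `f` comes after this earliest `y`. The vertex `v` found below is such a vertex, yet precedes
  -- `y`.
  obtain ⟨y, ⟨hyf, hyw⟩, hymin⟩ : ∃ y, (N y f ∧ ¬ N y w) ∧
      ∀ z, N z f → ¬ N z w → σ y ≤ σ z := by
    have hex : ∃ m y, (N y f ∧ ¬ N y w) ∧ σ y = m :=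
      ⟨_, f, ⟨h.refl f, fun hn => hwf (h.symm _ _ hn)⟩, rfl⟩
    classical
    obtain ⟨y, hy, hym⟩ := Nat.find_spec hex
    exact ⟨y, hy, fun z hz hz' => hym ▸ Nat.find_min' hex ⟨z, ⟨hz, hz'⟩, rfl⟩⟩
  have hyf' : σ y ≤ σ f := hymin f (h.refl f) fun hn => hwf (h.symm _ _ hn)
  have earlier : ∀ v, σ v < σ f → N v w → ¬ N v f → σ y < σ v := by
    intro v hvf hvw hvf'
    obtain ⟨z, hz, hzf, hzw⟩ := hL f w v hvf hfw hvw hvf'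
    exact lt_of_le_of_lt (hymin z hzf hzw) hz
  have hgf : ¬ N g f := fun hn =>
    hwf (h.symm _ _ (h.convex f w g (hf w) (hg w) (h.symm _ _ hn)).1)
  have hyg : σ y < σ g := by
    rcases lt_or_ge (σ f) (σ g) with h1 | h1
    · omega
    · exact earlier g (hlt h1 (hne hgf)) (h.symm _ _ hwg) hgf
  have hyx := hfw' y hyf hyw
  obtain ⟨v, hvy, hvg, hvx⟩ := hL g x y hyg hgx
    (h.convex y x s hyx.le hxs.le (h.symm _ _ (huniv y))).1 (fun hn => hyw (hgw y hn))
  have hvw := hgw v hvg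
  have hxv : π x < π v := by
    by_contra hle
    exact hxg (h.convex v x g (by omega) hxg'.le hvg).2
  have := earlier v (by omega) hvw
    (fun hn => hvx (h.symm _ _ (h.convex f x v (hf x) hxv.le (h.symm _ _ hn)).2))
  omega

theorem lt_of_startsBefore (h : IsStraight N π) {σ : α → ℕ} (hσ : σ.Injective)
    (hL : FourPoint N σ) {s f : α} (hs : ∀ v, σ s ≤ σ v) (hf : ∀ v, π f ≤ π v)
    (hsf : ∀ v, N s v ↔ N f v) {b c : α} (hbc : StartsBefore N π b c) : σ b < σ c := by
  have hfs : N f s := (hsf s).1 (h.refl s)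
  obtain ⟨x, hxc, hxb, hxc'⟩ := id hbc
  have hfc : ¬ N f c := fun hn => hxc' (h.convex f x c (hf x) hxc.le hn).2
  refine h.lt_of_startsBefore_of_first hσ hL hs c b hbc ?_ (fun hn => hfc ((hsf c).1 hn)) ?_
  · by_contra hle
    exact hfc (h.convex f c s (hf c) (by omega) hfs).1
  · rcases le_or_gt (π b) (π s) with h1 | h1
    · exact Or.inl (h.symm _ _ (h.convex f b s (hf b) h1 hfs).2)
    · exact Or.inr h1

theorem convex_third_of_first_twin_min [Finite α] [Nonempty α] (h : IsStraight N π)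
    {σ₂ σ₃ : α → ℕ} (hσ₂ : σ₂.Injective) (hσ₃ : σ₃.Injective) (hL₂ : FourPoint N σ₂)
    (hL₃ : FourPoint N σ₃) (hP : PlusTie N σ₂ σ₃) {s f g : α} (hs : ∀ v, σ₂ s ≤ σ₂ v)
    (hf : ∀ v, π f ≤ π v) (hg : ∀ v, π v ≤ π g) (hsf : ∀ v, N s v ↔ N f v)
    {a b c : α} (hab : σ₃ a < σ₃ b) (hbc : σ₃ b < σ₃ c) (hac : N a c) : N a b ∧ N b c := by
  have h2 : ∀ {b c : α}, StartsBefore N π b c → σ₂ b < σ₂ c := fun hbc =>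
    h.lt_of_startsBefore hσ₂ hL₂ hs hf hsf hbc
  obtain ⟨w, hw⟩ := Finite.exists_max σ₂
  obtain ⟨t, ht⟩ := Finite.exists_min σ₃
  have htw : t = w := by
    by_contra hne
    obtain ⟨d, hd, -⟩ := hP t w (lt_of_le_of_ne (ht w) (hσ₃.ne hne))
      (lt_of_le_of_ne (hw t) (hσ₂.ne hne))
    exact absurd (ht d) (by omega)
  subst htw
  have htg := h.twin_max_of_not_startsBefore hg (w := t)
    fun hst => absurd (hw g) (not_le.2 (h2 hst))
  -- Ends in `π` are starts in the reversed order, whose first vertex is `g`.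
  have h3 : ∀ {b c : α}, EndsAfter N π b c → σ₃ b < σ₃ c := fun hbc =>
    (h.reverse hg).lt_of_startsBefore hσ₃ hL₃ ht (f := g) (fun v => by omega) htg
      ((startsBefore_reverse hg).2 hbc)
  have hab' : ¬ EndsAfter N π b a := fun hh => by have := h3 hh; omega
  have hbc' : ¬ EndsAfter N π c b := fun hh => by have := h3 hh; omega
  have hnab : N a b := by
    by_contra hn
    have hba : π b < π a := by
      by_contra hle
      refine hab' ⟨b, lt_of_le_of_ne (by omega) fun he => hn (h.inj he ▸ h.refl _), h.refl b,
        fun hh => hn (h.symm _ _ hh)⟩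
    rcases lt_or_ge (π b) (π c) with h1 | h1
    · exact hbc' ⟨a, hba, hac, hn⟩
    · exact hn (h.symm _ _ (h.convex c b a h1 hba.le (h.symm _ _ hac)).2)
  refine ⟨hnab, ?_⟩
  by_contra hn
  have hcb : π c < π b := by
    by_contra hle
    exact hbc' ⟨c, lt_of_le_of_ne (by omega) fun he => hn (h.inj he ▸ h.refl _), h.refl c,
      fun hh => hn (h.symm _ _ hh)⟩
  have hab2 : π a < π b := by
    by_contra hle
    exact hn (h.symm _ _ (h.convex c b a hcb.le (by omega) (h.symm _ _ hac)).1)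
  have hst : StartsBefore N π a b := ⟨c, hcb, h.symm _ _ hac, fun hh => hn (h.symm _ _ hh)⟩
  -- Both sweeps put `a` before `b`, so an earlier `d` must favour `a`. But `b` shows that `a` ends
  -- after `d`, so `a` should precede `d`.
  obtain ⟨d, hd, hda, hdb⟩ := hP a b hab (h2 hst)
  have hdb' : π d < π b := by
    by_contra hle
    exact hdb (h.symm _ _ (h.convex a b d hab2.le (by omega) (h.symm _ _ hda)).2)
  have := h3 (b := a) (c := d) ⟨b, hdb', h.symm _ _ hnab, fun hh => hdb (h.symm _ _ hh)⟩
  omega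

theorem convex_third_sweep [Finite α] [Nonempty α] (h : IsStraight N π)
    {σ₁ σ₂ σ₃ : α → ℕ} (hσ₁ : σ₁.Injective) (hσ₂ : σ₂.Injective) (hσ₃ : σ₃.Injective)
    (hL₁ : FourPoint N σ₁) (hL₂ : FourPoint N σ₂) (hL₃ : FourPoint N σ₃)
    (hP₂ : PlusTie N σ₁ σ₂) (hP₃ : PlusTie N σ₂ σ₃)
    {a b c : α} (hab : σ₃ a < σ₃ b) (hbc : σ₃ b < σ₃ c) (hac : N a c) : N a b ∧ N b c := by
  obtain ⟨s, hs⟩ := Finite.exists_min σ₁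
  obtain ⟨w, hw⟩ := Finite.exists_max σ₁
  obtain ⟨t, ht⟩ := Finite.exists_min σ₂
  obtain ⟨f, hf⟩ := Finite.exists_min π
  obtain ⟨g, hg⟩ := Finite.exists_max π
  have htw : t = w := by
    by_contra hne
    obtain ⟨d, hd, -⟩ := hP₂ t w (lt_of_le_of_ne (ht w) (hσ₂.ne hne))
      (lt_of_le_of_ne (hw t) (hσ₁.ne hne))
    exact absurd (ht d) (by omega)
  subst htw
  have hf' : ∀ v, π g - π v ≤ π g - π f := fun v => by have := hf v; omega
  have hg' : ∀ v, π g - π g ≤ π g - π v := fun v => by omega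
  -- The end of `π` that is a twin of `t` is the one on the side of `t` away from `s`; it is made
  -- the first vertex.
  rcases le_total (π s) (π t) with h1 | h1
  · exact (h.reverse hg).convex_third_of_first_twin_min hσ₂ hσ₃ hL₂ hL₃ hP₃ ht hg' hf'
      (h.last_twin_max hσ₁ hL₁ hs hw hf hg h1) hab hbc hac
  · exact h.convex_third_of_first_twin_min hσ₂ hσ₃ hL₂ hL₃ hP₃ ht hf hg
      ((h.reverse hg).last_twin_max hσ₁ hL₁ hs hw hg' hf' (by omega)) hab hbc hac

end IsStraight

/-! ### Labels and their lexicographic comparison -/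

namespace LexBFSState

variable {V : Type*}

/-- The label of a vertex `w` after the vertices of a list have been numbered, when the letters
decrease from `k - 1` on. -/
def word (G : SimpleGraph V) [DecidableRel G.Adj] : ℕ → List V → V → List ℕ
  | _, [], _ => []
  | k, v :: vs, w => if G.Adj v w then (k - 1) :: word G (k - 1) vs w else word G (k - 1) vs w

section word

variable {G : SimpleGraph V} [DecidableRel G.Adj]

theorem word_concat (k : ℕ) (vs : List V) (v w : V) :
    word G k (vs ++ [v]) w =
      if G.Adj v w then word G k vs w ++ [k - (vs.length + 1)] else word G k vs w := by
  induction vs generalizing k with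
  | nil => by_cases h : G.Adj v w <;> simp [word, h]
  | cons u vs ih =>
    have hk : k - 1 - (vs.length + 1) = k - (vs.length + 1 + 1) := by omega
    by_cases h : G.Adj v w <;> by_cases h' : G.Adj u w <;> simp [word, ih, h, h', hk]

/-- The length bound keeps truncated subtraction from repeating the letter 0. -/
theorem lt_of_mem_word {k : ℕ} {vs : List V} (hk : vs.length ≤ k) {w : V} {m : ℕ}
    (hm : m ∈ word G k vs w) : m < k := by
  induction vs generalizing k with
  | nil => simp [word] at hm
  | cons u vs ih =>
    simp only [List.length_cons] at hk
    have := @ih (k - 1) (by omega)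
    by_cases h : G.Adj u w
    · simp only [word, h, if_true, List.mem_cons] at hm
      rcases hm with hm | hm
      · omega
      · have := this hm; omega
    · simp only [word, h, if_false] at hm
      have := this hm; omega

/-- The first vertex adjacent to just one of `b`, `c` decides the comparison, since all later
letters are smaller; so it is a neighbour of `b` and precedes `d`. -/
theorem exists_mem_of_word_le {k : ℕ} {vs : List V} (hk : vs.length ≤ k) {b c : V}
    (hle : word G k vs c ≤ word G k vs b) {p : List V} {d : V} (hp : p ++ [d] <+: vs)
    (hdc : G.Adj d c) (hdb : ¬ G.Adj d b) : ∃ d' ∈ p, G.Adj d' b ∧ ¬ G.Adj d' c := by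
  induction vs generalizing k p with
  | nil => simp at hp
  | cons u vs ih =>
    simp only [List.length_cons] at hk
    have hk' : vs.length ≤ k - 1 := by omega
    have hnot : ¬ (G.Adj u c ∧ ¬ G.Adj u b) := by
      rintro ⟨h1, h2⟩
      simp only [word, h1, h2, if_true, if_false] at hle
      rcases hw : word G (k - 1) vs b with _ | ⟨m, l⟩
      · rw [hw] at hle
        exact absurd hle (by simp)
      · have hm : m < k - 1 := lt_of_mem_word hk' (by rw [hw]; simp)
        rw [hw] at hle
        exact absurd hle (not_le.2 (List.Lex.rel hm))
    rcases p with _ | ⟨u', p⟩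
    · have : d = u := by simpa using hp
      exact absurd ⟨this ▸ hdc, this ▸ hdb⟩ hnot
    · rw [List.cons_append, List.cons_prefix_cons] at hp
      obtain ⟨rfl, hp⟩ := hp
      by_cases hb : G.Adj u' b
      · by_cases hc : G.Adj u' c
        · simp only [word, hb, hc, if_true] at hle
          obtain ⟨d', h1, h2⟩ := ih hk' (not_lt.1 fun hlt => absurd hle
            (not_le.2 (List.Lex.cons hlt))) hp
          exact ⟨d', List.mem_cons_of_mem _ h1, h2⟩
        · exact ⟨u', List.mem_cons_self, hb, hc⟩
      · have hc : ¬ G.Adj u' c := fun hc => hnot ⟨hc, hb⟩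
        simp only [word, hb, hc, if_false] at hle
        obtain ⟨d', h1, h2⟩ := ih hk' hle hp
        exact ⟨d', List.mem_cons_of_mem _ h1, h2⟩

theorem word_congr (k : ℕ) (vs : List V) {b c : V} (h : ∀ d ∈ vs, G.Adj d b ↔ G.Adj d c) :
    word G k vs b = word G k vs c := by
  induction vs generalizing k with
  | nil => rfl
  | cons u vs ih =>
    simp only [word, ih (k - 1) fun d hd => h d (List.mem_cons_of_mem _ hd),
      h u List.mem_cons_self]

theorem exists_mem_of_word_lt {k : ℕ} {vs : List V} (hk : vs.length ≤ k) {b c : V}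
    (hle : word G k vs c ≤ word G k vs b) (hne : word G k vs c ≠ word G k vs b) :
    ∃ d ∈ vs, G.Adj d b ∧ ¬ G.Adj d c := by
  by_contra! hcon
  refine hne (word_congr k vs fun d hd => ⟨fun hdc => ?_, hcon d hd⟩)
  by_contra hdb
  obtain ⟨p, q, rfl⟩ := List.append_of_mem hd
  obtain ⟨d', h1, h2, h3⟩ := exists_mem_of_word_le hk hle (p := p) (d := d)
    ⟨q, by simp⟩ hdc hdb
  exact h3 (hcon d' (List.mem_append_left _ h1) h2)

end word

variable [Fintype V] [DecidableEq V] {G : SimpleGraph V} [DecidableRel G.Adj]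

/-- The labels of the unnumbered vertices are those that result from numbering the visited
vertices, in their order, from empty labels on. -/
def HasWords (G : SimpleGraph V) [DecidableRel G.Adj] (st : LexBFSState V) : Prop :=
  ∀ w, w ∉ st.visited → st.label w = word G (Fintype.card V) st.visited w

theorem HasWords.visit {st : LexBFSState V} (h : st.HasWords G) (v : V) :
    (st.visit G v).HasWords G := by
  intro w hw
  have hw' : w ∉ st.visited := fun hm => hw (List.mem_append_left _ hm)
  have hw2 : w ∉ st.visited ++ [v] := hw
  simp only [LexBFSState.visit, word_concat, hw2, not_false_eq_true, true_and, h w hw']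

/-- The letter `n + 1` forces `s` to be picked first; afterwards it sits only on a numbered vertex.
-/
theorem Reachable.visited_eq_nil_or {s : V} {st : LexBFSState V} (h : Reachable G s st) :
    st = init s ∨ s ∈ st.visited ∧ st.HasWords G := by
  induction h with
  | start => exact Or.inl rfl
  | step st v _ hv ih =>
    refine Or.inr ?_
    rcases ih with rfl | ⟨hs, hw⟩
    · obtain rfl : v = s := by
        by_contra hne
        exact absurd (hv.2 s (by simp [init])) (by simp [init, hne])
      refine ⟨by simp [LexBFSState.visit], fun w hw => ?_⟩
      have hws : w ≠ v := by simpa [LexBFSState.visit, init] using hw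
      by_cases hvw : G.Adj v w <;> simp [LexBFSState.visit, init, word, hws, hvw]
    · exact ⟨List.mem_append_left _ hs, hw.visit v⟩

theorem Reachable.word_le {s : V} {st : LexBFSState V} (h : Reachable G s st) {p : List V}
    {b : V} (hp : p ++ [b] <+: st.visited) {c : V} (hc : c ∉ p) :
    word G (Fintype.card V) p c ≤ word G (Fintype.card V) p b := by
  induction h with
  | start => simp [init] at hp
  | step st v hst hv ih =>
    rcases List.prefix_concat_iff.1 hp with hp | hp
    · obtain ⟨rfl, rfl⟩ := List.append_singleton_inj.1 hp
      rcases hst.visited_eq_nil_or with rfl | ⟨-, hw⟩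
      · exact le_rfl
      · rw [← hw c hc, ← hw b hv.1]
        exact hv.2 c hc
    · exact ih hp

theorem plusState_succ (σ : VertexOrdering V) (k : ℕ) :
    plusState G σ (k + 1) = plusStep G σ (plusState G σ k) :=
  Function.iterate_succ_apply' _ _ _

theorem plusStep_eq (σ : VertexOrdering V) (st : LexBFSState V) :
    plusStep G σ st = st ∨ ∃ v, plusStep G σ st = st.visit G v ∧ st.Eligible v ∧
      ∀ c, st.Eligible c → σ c ≤ σ v := by
  by_cases h : st.tied.Nonempty
  · refine Or.inr ⟨_, by rw [plusStep, dif_pos h], ?_, fun c hc => ?_⟩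
    · obtain ⟨x, hx, hxe⟩ := Finset.mem_image.1 (Finset.max'_mem _ (h.image σ))
      rw [← hxe, Equiv.symm_apply_apply]
      exact (Finset.mem_filter.1 hx).2
    · rw [Equiv.apply_symm_apply]
      exact Finset.le_max' _ _
        (Finset.mem_image_of_mem _ (Finset.mem_filter.2 ⟨Finset.mem_univ _, hc⟩))
  · exact Or.inl (by rw [plusStep, dif_neg h])

theorem plusState_hasWords (σ : VertexOrdering V) (k : ℕ) : (plusState G σ k).HasWords G := by
  induction k with
  | zero => exact fun _ _ => rfl
  | succ k ih =>
    rw [plusState_succ]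
    rcases plusStep_eq (G := G) σ (plusState G σ k) with h | ⟨v, h, -⟩ <;> rw [h]
    · exact ih
    · exact ih.visit v

theorem plusState_word_le (σ : VertexOrdering V) (k : ℕ) {p : List V} {b : V}
    (hp : p ++ [b] <+: (plusState G σ k).visited) {c : V} (hc : c ∉ p) :
    word G (Fintype.card V) p c ≤ word G (Fintype.card V) p b ∧
      (word G (Fintype.card V) p c = word G (Fintype.card V) p b → σ c ≤ σ b) := by
  induction k with
  | zero => simp [plusState, initTied] at hp
  | succ k ih =>
    rw [plusState_succ] at hp
    rcases plusStep_eq (G := G) σ (plusState G σ k) with h | ⟨v, h, hv, hmax⟩ <;> rw [h] at hp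
    · exact ih hp
    rcases List.prefix_concat_iff.1 hp with hp | hp
    · obtain ⟨rfl, rfl⟩ := List.append_singleton_inj.1 hp
      have hw := plusState_hasWords (G := G) σ k
      rw [← hw c hc, ← hw b hv.1]
      exact ⟨hv.2 c hc, fun he => hmax c ⟨hc, fun w hw => he ▸ hv.2 w hw⟩⟩
    · exact ih hp

end LexBFSState

/-! ### Prefixes of an ordering -/

namespace VertexOrdering

variable {V : Type*} [Fintype V]

theorem take_concat_prefix (σ : VertexOrdering V) (b : V) :
    σ.vertexList.take (σ b) ++ [b] <+: σ.vertexList := by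
  have hlt : (σ b : ℕ) < σ.vertexList.length := by simp [vertexList]
  have hb : σ.vertexList[(σ b : ℕ)] = b := by simp [vertexList]
  have := List.take_concat_get' _ _ hlt
  rw [hb] at this
  rw [this]
  exact List.take_prefix _ _

theorem mem_take (σ : VertexOrdering V) (b v : V) :
    v ∈ σ.vertexList.take (σ b) ↔ σ v < σ b := by
  rw [List.mem_take_iff_getElem]
  constructor
  · rintro ⟨i, hi, rfl⟩
    simp only [vertexList, List.getElem_ofFn, Equiv.apply_symm_apply]
    exact Fin.lt_def.2 (by simp only; omega)
  · intro h
    exact ⟨σ v, by simpa [vertexList] using h, by simp [vertexList]⟩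

theorem take_concat_prefix_take (σ : VertexOrdering V) {b d : V} (h : σ d < σ b) :
    σ.vertexList.take (σ d) ++ [d] <+: σ.vertexList.take (σ b) := by
  refine List.prefix_of_prefix_length_le (σ.take_concat_prefix d) (List.take_prefix _ _) ?_
  have := (σ b).2
  simp [vertexList]
  omega

theorem length_take_le (σ : VertexOrdering V) (b : V) :
    (σ.vertexList.take (σ b)).length ≤ Fintype.card V := by
  simp [vertexList]

end VertexOrdering

/-! ### From graphs to components, and back to the sweeps -/

section LexBFS

open LexBFSState

variable {V : Type*} {G : SimpleGraph V} {C : G.ConnectedComponent}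

/-- The components of a graph are consecutive in every search with the four-point property. -/
theorem FourPoint.reachable {σ : V → ℕ} (h : FourPoint G.Adj σ) {a b c : V} (hab : σ a < σ b)
    (hbc : σ b < σ c) (hac : G.Adj a c) : G.Reachable a b := by
  induction hm : σ a using Nat.strong_induction_on generalizing a b c with
  | _ m ih =>
  subst hm
  by_cases hn : G.Adj a b
  · exact hn.reachable
  obtain ⟨d, hda, hdb, -⟩ := h b c a hab hbc hac hn
  exact (ih _ hda hda hab hdb rfl).symm.trans hdb.reachable

/-- A connected graph has an edge across every cut. -/
theorem SimpleGraph.Reachable.exists_adj_of_mem_of_notMem {W : Type*} {H : SimpleGraph W} {u v : W}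
    (h : H.Reachable u v) {s : Set W} (hu : u ∈ s) (hv : v ∉ s) :
    ∃ x y, H.Adj x y ∧ x ∈ s ∧ y ∉ s := by
  obtain ⟨p⟩ := h
  obtain ⟨d, -, h1, h2⟩ := p.exists_boundary_dart s hu hv
  exact ⟨_, _, d.adj, h1, h2⟩

/-- The closed adjacency relation of a graph, on the vertices of a component. -/
def closedAdjOn (G : SimpleGraph V) (C : G.ConnectedComponent) (u v : C.supp) : Prop :=
  u = v ∨ G.Adj u v

theorem adj_mem_supp {u v : V} (hu : u ∈ C.supp) (h : G.Adj u v) : v ∈ C.supp :=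
  (C.mem_supp_congr_adj h).1 hu

theorem FourPoint.closedAdjOn {σ : V → ℕ} (h : FourPoint G.Adj σ) :
    FourPoint (closedAdjOn G C) (fun v => σ v) := by
  rintro b c d hdb hbc hdc hdb'
  have hdc' : G.Adj d c := hdc.resolve_left (by rintro rfl; simp only at hdb hbc; omega)
  obtain ⟨d', h1, h2, h3⟩ := h b c d hdb hbc hdc' fun hn => hdb' (Or.inr hn)
  refine ⟨⟨d', adj_mem_supp b.2 h2.symm⟩, h1, Or.inr h2, ?_⟩
  rintro (rfl | h4)
  · simp only at hdb hbc h1; omega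
  · exact h3 h4

theorem PlusTie.closedAdjOn {τ σ : V → ℕ} (h : PlusTie G.Adj τ σ) :
    PlusTie (closedAdjOn G C) (fun v => τ v) (fun v => σ v) := by
  rintro b c hbc hτ
  obtain ⟨d, h1, h2, h3⟩ := h b c hbc hτ
  refine ⟨⟨d, adj_mem_supp b.2 h2.symm⟩, h1, Or.inr h2, ?_⟩
  rintro (rfl | h4)
  · simp only at hbc h1; omega
  · exact h3 h4

theorem isStraight_closedAdjOn {π : V → ℕ} (hπ : π.Injective)
    (h : ∀ a b c, π a < π b → π b < π c → G.Adj a c → G.Adj a b ∧ G.Adj b c) :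
    IsStraight (closedAdjOn G C) (fun v => π v) := by
  have hsymm : ∀ a b : C.supp, _root_.closedAdjOn G C a b → _root_.closedAdjOn G C b a :=
    fun a b hab => hab.imp Eq.symm SimpleGraph.Adj.symm
  have hinj : Function.Injective (fun v : C.supp => π v) := fun a b hab => Subtype.ext (hπ hab)
  have hreach : ∀ a b : C.supp, G.Reachable a b := fun a b =>
    SimpleGraph.ConnectedComponent.exact ((show _ = C from a.2).trans (show _ = C from b.2).symm)
  refine ⟨hinj, fun a => Or.inl rfl, hsymm, ?_, ?_, ?_⟩
  · intro a b c hab hbc hac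
    rcases hab.lt_or_eq with h1 | h1
    · rcases hbc.lt_or_eq with h2 | h2
      · have hne : a ≠ c := by rintro rfl; exact absurd (h1.trans h2) (lt_irrefl _)
        obtain ⟨h3, h4⟩ := h a b c h1 h2 (hac.resolve_left hne)
        exact ⟨Or.inr h3, Or.inr h4⟩
      · obtain rfl := hinj h2
        exact ⟨hac, Or.inl rfl⟩
    · obtain rfl := hinj h1
      exact ⟨Or.inl rfl, hac⟩
  · intro a b hab
    -- An edge crosses the cut just left of `b`; by convexity its left end is adjacent to `b`.
    obtain ⟨x, y, hxy, hx, hy⟩ := (hreach a b).exists_adj_of_mem_of_notMem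
      (s := {v | π v < π b}) hab (lt_irrefl (π b))
    have hxb : G.Adj x b := by
      rcases (le_of_not_gt (α := ℕ) hy).lt_or_eq with h1 | h1
      · exact (h x b y hx h1 hxy).1
      · rwa [hπ h1]
    exact ⟨⟨x, adj_mem_supp b.2 hxb.symm⟩, hx, Or.inr hxb⟩
  · intro a b hab
    obtain ⟨x, y, hxy, hx, hy⟩ := (hreach a b).exists_adj_of_mem_of_notMem
      (s := {v | π b < π v}) hab (lt_irrefl (π b))
    have hxb : G.Adj x b := by
      rcases (le_of_not_gt (α := ℕ) hy).lt_or_eq with h1 | h1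
      · exact (h y b x h1 hx hxy.symm).2.symm
      · rwa [← hπ h1]
    exact ⟨⟨x, adj_mem_supp b.2 hxb.symm⟩, hx, Or.inr hxb⟩

variable [Fintype V]

theorem IsPIOrder.dual {σ : VertexOrdering V} (h : IsPIOrder G σ) : IsPIOrder G σ.dual := by
  intro a b c hab hbc hac
  obtain ⟨h1, h2⟩ := h c b a (Fin.rev_lt_rev.1 hbc) (Fin.rev_lt_rev.1 hab) hac.symm
  exact ⟨h2.symm, h1.symm⟩

theorem VertexOrdering.dual_dual (σ : VertexOrdering V) : σ.dual.dual = σ :=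
  Equiv.ext fun v => Fin.rev_rev (σ v)

/-- An ordering that reverses all pairs of another one is its dual. -/
theorem VertexOrdering.eq_dual {σ τ : VertexOrdering V} (h : ∀ a b, σ a < σ b → τ b < τ a) :
    σ = τ.dual := by
  have hmono : StrictMono (τ.dual.symm.trans σ) := by
    intro i j hij
    by_contra hle
    rcases (not_lt.1 hle).lt_or_eq with h1 | h1
    · have h2 := h _ _ h1
      have h3 : τ.dual (τ.dual.symm j) < τ.dual (τ.dual.symm i) := Fin.rev_lt_rev.2 h2
      simp only [Equiv.apply_symm_apply] at h3
      exact absurd hij h3.not_gt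
    · exact absurd ((τ.dual.symm.trans σ).injective h1) hij.ne'
  have hid : ⇑(τ.dual.symm.trans σ) = id := by
    have := Subsingleton.elim
      (hmono.orderIsoOfSurjective _ (τ.dual.symm.trans σ).surjective) (OrderIso.refl _)
    ext i
    exact congrArg Fin.val (DFunLike.congr_fun this i)
  ext v
  have := congrFun hid (τ.dual v)
  simpa using congrArg Fin.val this

/-- A proper interval graph has an injective numbering with the property of a PI-order. -/
theorem IsProperIntervalGraph.exists_numbering (hG : IsProperIntervalGraph G) :
    ∃ π : V → ℕ, π.Injective ∧
      ∀ a b c, π a < π b → π b < π c → G.Adj a c → G.Adj a b ∧ G.Adj b c := by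
  obtain ⟨l, r, hlr, hprop, hadj⟩ := hG
  -- Without proper containment, right endpoints follow the order of left endpoints.
  have hr : ∀ {u v}, l u ≤ l v → r u ≤ r v := by
    intro u v huv
    by_contra hlt
    push Not at hlt
    refine hprop v u ⟨Set.Icc_subset_Icc huv hlt.le, fun hss => ?_⟩
    exact absurd (hss ⟨hlr u, le_rfl⟩).2 (not_le.2 hlt)
  let e := Fintype.equivFin V
  let f : V → ℝ ×ₗ Fin (Fintype.card V) := fun v => toLex (l v, e v)
  have hf : f.Injective := fun u v huv => e.injective (congrArg (fun x => (ofLex x).2) huv)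
  let _ : LinearOrder V := LinearOrder.lift' f hf
  let π : V → ℕ := fun v => (monoEquivOfFin V rfl).symm v
  have hπ : ∀ {u v}, π u < π v → l u ≤ l v := by
    intro u v huv
    have h1 : u < v := (monoEquivOfFin V rfl).symm.lt_iff_lt.1 huv
    have h2 : f u < f v := h1
    rcases Prod.Lex.lt_iff.1 h2 with h3 | h3
    · exact h3.le
    · exact h3.1.le
  refine ⟨π, fun u v huv => (monoEquivOfFin V rfl).symm.injective (Fin.ext huv), ?_⟩
  intro a b c hab hbc hac
  have h1 := hπ hab
  have h2 := hπ hbc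
  obtain ⟨x, ⟨-, hx1⟩, ⟨hx2, -⟩⟩ := ((hadj a c).1 hac).2
  have hca : l c ≤ r a := hx2.trans hx1
  have h3 := hr h1
  have hbb := hlr b
  have hcc := hlr c
  have haa := hlr a
  refine ⟨(hadj a b).2 ⟨fun he => hab.ne (he ▸ rfl), l b, ⟨h1, h2.trans hca⟩, le_rfl, hbb⟩,
    (hadj b c).2 ⟨fun he => hbc.ne (he ▸ rfl), l c, ⟨h2, hca.trans h3⟩, le_rfl, hcc⟩⟩

variable [DecidableRel G.Adj]

theorem fourPoint_of_word_le {σ : VertexOrdering V}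
    (h : ∀ p b c, p ++ [b] <+: σ.vertexList → c ∉ p →
      word G (Fintype.card V) p c ≤ word G (Fintype.card V) p b) :
    FourPoint G.Adj (fun v => (σ v : ℕ)) := by
  intro b c d hdb hbc hdc hdb'
  obtain ⟨d', h1, h2⟩ := exists_mem_of_word_le (σ.length_take_le b)
    (h _ b c (σ.take_concat_prefix b) (by rw [σ.mem_take]; exact not_lt.2 hbc.le))
    (σ.take_concat_prefix_take hdb) hdc hdb'
  exact ⟨d', (σ.mem_take d d').1 h1, h2⟩

variable [DecidableEq V]

theorem IsLexBFS.fourPoint {σ : VertexOrdering V} (h : IsLexBFS G σ) :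
    FourPoint G.Adj (fun v => (σ v : ℕ)) := by
  obtain ⟨s, st, hst, hσ⟩ := h
  exact fourPoint_of_word_le fun p b c hp hc => hst.word_le (hσ ▸ hp) hc

theorem vertexList_lexBFSPlus (τ : VertexOrdering V) :
    (lexBFSPlus G τ).vertexList = (plusState G τ (Fintype.card V)).visited := by
  have hlen := (plusState_nodup_length G τ _ le_rfl).2
  refine List.ext_getElem (by simp [VertexOrdering.vertexList, hlen]) fun i h1 h2 => ?_
  simp only [VertexOrdering.vertexList, List.getElem_ofFn]
  rfl

theorem fourPoint_lexBFSPlus (τ : VertexOrdering V) :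
    FourPoint G.Adj (fun v => (lexBFSPlus G τ v : ℕ)) :=
  fourPoint_of_word_le fun _ _ _ hp hc =>
    (plusState_word_le τ _ (vertexList_lexBFSPlus (G := G) τ ▸ hp) hc).1

theorem plusTie_lexBFSPlus (τ : VertexOrdering V) :
    PlusTie G.Adj (fun v => (τ v : ℕ)) (fun v => (lexBFSPlus G τ v : ℕ)) := by
  intro b c hbc hτ
  set σ := lexBFSPlus G τ with hσ
  have hp := σ.take_concat_prefix b
  rw [hσ, vertexList_lexBFSPlus, ← hσ] at hp
  obtain ⟨h1, h2⟩ := plusState_word_le (c := c) τ _ hp (by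
    rw [← vertexList_lexBFSPlus, ← hσ, σ.mem_take]; exact not_lt.2 hbc.le)
  obtain ⟨d, hd, hd'⟩ := exists_mem_of_word_lt
    (by simp [(plusState_nodup_length G τ _ le_rfl).2]) h1
    fun he => absurd (h2 he) (not_le.2 hτ)
  rw [← vertexList_lexBFSPlus, ← hσ, σ.mem_take] at hd
  exact ⟨d, hd, hd'⟩

/-- Let `b`, `c` be a pair left unreversed, with `b` earliest. The tie rule gives an earlier `d`
adjacent to `b` but not to `c`. The pair `d`, `c` is reversed, so `c` lies between `b` and `d` in
`τ`, and the edge `b d` forces `c d`. -/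
theorem IsPIOrder.lexBFSPlus_eq_dual {τ : VertexOrdering V} (h : IsPIOrder G τ) :
    lexBFSPlus G τ = τ.dual := by
  refine VertexOrdering.eq_dual fun b c => ?_
  set σ := lexBFSPlus G τ with hσ
  intro hbc
  induction hm : (σ b : ℕ) using Nat.strong_induction_on generalizing b c with
  | _ m ih =>
  subst hm
  by_contra hcon
  have hne : b ≠ c := fun he => hbc.ne (he ▸ rfl)
  have hτ : τ b < τ c := lt_of_le_of_ne (not_lt.1 hcon) (τ.injective.ne hne)
  obtain ⟨d, hd, hdb, hdc⟩ := plusTie_lexBFSPlus (G := G) τ b c hbc hτ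
  have hdc' := ih _ hd d c (lt_trans hd hbc) rfl
  exact hdc (h b c d hτ hdc' hdb.symm).2.symm

theorem IsProperIntervalGraph.isPIOrder_third_sweep (hG : IsProperIntervalGraph G)
    {σ : VertexOrdering V} (hσ : IsLexBFS G σ) :
    IsPIOrder G (lexBFSPlus G (lexBFSPlus G σ)) := by
  intro a b c hab hbc hac
  obtain ⟨π, hπ, hπ'⟩ := hG.exists_numbering
  let C := G.connectedComponentMk a
  have hreach := (fourPoint_lexBFSPlus (G := G) (lexBFSPlus G σ)).reachable hab hbc hac
  have hinj : ∀ τ : VertexOrdering V, Function.Injective (fun v : C.supp => (τ v : ℕ)) :=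
    fun τ u v huv => Subtype.ext (τ.injective (Fin.ext huv))
  have ha : a ∈ C.supp := rfl
  have hb : b ∈ C.supp := SimpleGraph.ConnectedComponent.sound hreach.symm
  have : Nonempty C.supp := ⟨⟨a, ha⟩⟩
  obtain ⟨h1, h2⟩ := (isStraight_closedAdjOn (C := C) hπ hπ').convex_third_sweep
    (hinj σ) (hinj _) (hinj _) hσ.fourPoint.closedAdjOn
    (fourPoint_lexBFSPlus σ).closedAdjOn (fourPoint_lexBFSPlus _).closedAdjOn
    (plusTie_lexBFSPlus σ).closedAdjOn (plusTie_lexBFSPlus _).closedAdjOn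
    (a := ⟨a, ha⟩) (b := ⟨b, hb⟩) (c := ⟨c, adj_mem_supp ha hac⟩) hab hbc (Or.inr hac)
  refine ⟨h1.resolve_left fun he => ?_, h2.resolve_left fun he => ?_⟩
  · exact hab.ne (congrArg (fun v => lexBFSPlus G (lexBFSPlus G σ) v) (congrArg Subtype.val he))
  · exact hbc.ne (congrArg (fun v => lexBFSPlus G (lexBFSPlus G σ) v) (congrArg Subtype.val he))

end LexBFS

theorem mainTheorem11 {V : Type*} [Fintype V] [DecidableEq V] (G : SimpleGraph V)
    [DecidableRel G.Adj] (hG : IsProperIntervalGraph G)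
    (σ₁ : VertexOrdering V) (hσ₁ : IsLexBFS G σ₁) :
    IsPIOrder G (sweep G σ₁ 3) ∧
      sweep G σ₁ 4 = (sweep G σ₁ 3).dual ∧
      sweep G σ₁ 5 = sweep G σ₁ 3 ∧
      ∃ k, k ≤ 5 ∧ RepeatedLexBFSStopsAt G σ₁ k := by
  have h3 : IsPIOrder G (sweep G σ₁ 3) := hG.isPIOrder_third_sweep hσ₁
  have h4 : sweep G σ₁ 4 = (sweep G σ₁ 3).dual := h3.lexBFSPlus_eq_dual
  have h5 : sweep G σ₁ 5 = sweep G σ₁ 3 := by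
    change lexBFSPlus G (sweep G σ₁ 4) = _
    rw [h4, h3.dual.lexBFSPlus_eq_dual, VertexOrdering.dual_dual]
  refine ⟨h3, h4, h5, ?_⟩
  by_cases h31 : sweep G σ₁ 3 = sweep G σ₁ 1
  · exact ⟨3, by norm_num, .exit 3 h31⟩
  by_cases h42 : sweep G σ₁ 4 = sweep G σ₁ 2
  · exact ⟨4, by norm_num, .next 3 4 h31 (.exit 4 h42)⟩
  · exact ⟨5, le_rfl, .next 3 5 h31 (.next 4 5 h42 (.exit 5 h5))⟩
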